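/- Consider first-order sentences over the vocabulary $\langle <, S;\ \min, \max\rangle$, with a binary predicate $<$, a unary predicate $S$ and constant symbols $\min,\max$. An $n$-bit string $w=w_1\cdots w_n\in\{0,1\}^n$, $n\ge 1$, is identified with the structure with universe $\{1,\dots,n\}$ in which $<$ is the usual order, $S=\{i : w_i=1\}$, $\min=1$ and $\max=n$. A sentence separates $w$ from a set $\mathcal B$ of $n$-bit strings if it is true in $w$ and false in every string of $\mathcal B$. Theorem. For every integer $t\ge 2$ there is a constant $C_t$, depending only on $t$, such that the following holds. Let $f:\mathbb N\to\mathbb N$ be a function with $\lim_{n\to\infty} f(n)=\infty$. Then for all $n\ge 1$, every $n$-bit string $w$ and every set $\mathcal B\subseteq\{0,1\}^n\setminus\{w\}$ with $|\mathcal B|=f(n)$, there is a sentence with at most $$\log_2 n+\log_t f(n)+C_t$$ quantifiers (quantifier occurrences) that separates $w$ from $\mathcal B$. (If $f(n)=0$, the term $\log_t f(n)$ is read as $0$.) -/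

import Mathlib

open Filter

namespace BitString

/-- The function symbols of the vocabulary of binary strings: the constants `min` and `max`. -/
inductive Func : ℕ → Type
  | min : Func 0
  | max : Func 0

/-- The relation symbols of the vocabulary of binary strings: the binary predicate `<` and the
unary predicate `S`. -/
inductive Rel : ℕ → Type
  | lt : Rel 2
  | S : Rel 1

/-- The vocabulary `⟨<, S ; min, max⟩` of binary strings. -/
def vocabulary : FirstOrder.Language.{0, 0} := ⟨Func, Rel⟩

/-- The structure of a nonempty `n`-bit string `w`. The positions are `0, …, n - 1`, `<` is their
usual order, `S` holds at the positions where `w` has a `1`, and `min` and `max` are the first and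
the last position. -/
@[reducible]
def toStructure {n : ℕ} (hn : 0 < n) (w : Fin n → Bool) : vocabulary.Structure (Fin n) where
  funMap := fun f _ => match f with
    | Func.min => ⟨0, hn⟩
    | Func.max => ⟨n - 1, Nat.sub_lt hn Nat.one_pos⟩
  RelMap := fun R => match R with
    | Rel.lt => fun x => x 0 < x 1
    | Rel.S => fun x => w (x 0) = true

/-- The sentence `φ` is true in the string `w`. -/
def Satisfies {n : ℕ} (hn : 0 < n) (w : Fin n → Bool) (φ : vocabulary.Sentence) : Prop :=
  @FirstOrder.Language.Sentence.Realize vocabulary (Fin n) (toStructure hn w) φ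

/-- The sentence `φ` separates the sets `A` and `B` of `n`-bit strings: it is true in every string
of `A` and false in every string of `B`. -/
def Separates {n : ℕ} (hn : 0 < n) (φ : vocabulary.Sentence) (A B : Set (Fin n → Bool)) : Prop :=
  (∀ w ∈ A, Satisfies hn w φ) ∧ ∀ w ∈ B, ¬ Satisfies hn w φ

/-- The number of occurrences of quantifiers in a first-order formula. An existential quantifier
`∃ x, φ` is `¬ ∀ x, ¬ φ` and counts once; the connectives `¬`, `∧`, `∨` are expressed through
`⊥` and `→` without repeating a subformula. -/
def numQuantifiers {L : FirstOrder.Language.{0, 0}} {α : Type} :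
    {k : ℕ} → L.BoundedFormula α k → ℕ
  | _, .falsum => 0
  | _, .equal _ _ => 0
  | _, .rel _ _ => 0
  | _, .imp φ ψ => numQuantifiers φ + numQuantifiers ψ
  | _, .all φ => numQuantifiers φ + 1

end BitString

/-! ### Atomic types and definability with a fixed quantifier prefix. -/

namespace BitString

open FirstOrder Language

/-! For each `b ∈ B` fix a position where `b` differs from `w`, and code the elements of `B` by
words of length `K ≈ log_t |B|` over `t` letters. The sentence marks `t` distinct points as letters
(∃), lets an opponent spell a word (`K` times ∀), then guesses the coded position together with
`min` and `max` (3 times ∃) and claims that the string agrees with `w` there. It remains to check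
that the guess is the coded position, by bounding its distances to both ends from below. Each
quantifier roughly halves the distances in question, and both are treated at once, so about `log_2
n` quantifiers suffice (`add_le_and_add_le_iff`, `prenexDefinable_add_le_and_add_le`). Branches of a
case distinction on atomic types share one quantifier prefix (`PrenexDefinable.select`), so their
costs do not add up; this lets all words and all subintervals be handled in parallel.
`exists_sentence_agree` assembles the sentence. If `n < t`, there is no room for `t` letters and `w`
is described outright. -/

/-- Two pebbled strings satisfy the same atomic formulas in the pebbled positions. -/
structure AtomicEquiv {n k : ℕ} (w : Fin n → Bool) (v : Fin k → Fin n) (w' : Fin n → Bool)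
    (v' : Fin k → Fin n) : Prop where
  lt_iff : ∀ i j, v i < v j ↔ v' i < v' j
  letter_eq : ∀ i, w (v i) = w' (v' i)
  min_iff : ∀ i, (v i : ℕ) = 0 ↔ (v' i : ℕ) = 0
  max_iff : ∀ i, (v i : ℕ) = n - 1 ↔ (v' i : ℕ) = n - 1

namespace AtomicEquiv

variable {n k : ℕ} {w w' : Fin n → Bool} {v v' : Fin k → Fin n}

theorem le_iff (h : AtomicEquiv w v w' v') (i j : Fin k) : v i ≤ v j ↔ v' i ≤ v' j := by
  rw [← not_lt, ← not_lt, h.lt_iff]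

theorem eq_iff (h : AtomicEquiv w v w' v') (i j : Fin k) : v i = v j ↔ v' i = v' j := by
  rw [le_antisymm_iff, le_antisymm_iff, h.le_iff, h.le_iff]

theorem of_snoc {x x' : Fin n}
    (h : AtomicEquiv w (Fin.snoc v x : Fin (k + 1) → Fin n) w' (Fin.snoc v' x')) :
    AtomicEquiv w v w' v' where
  lt_iff i j := by simpa using h.lt_iff i.castSucc j.castSucc
  letter_eq i := by simpa using h.letter_eq i.castSucc
  min_iff i := by simpa using h.min_iff i.castSucc
  max_iff i := by simpa using h.max_iff i.castSucc

end AtomicEquiv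

/-- A relation between `n`-bit strings and `k`-tuples of positions is definable by a prenex formula
whose quantifiers are listed in `Q`, with `true` for `∃` and `false` for `∀`. -/
def PrenexDefinable {n : ℕ} :
    List Bool → (k : ℕ) → ((Fin n → Bool) → (Fin k → Fin n) → Prop) → Prop
  | [], _, P => ∀ w v w' v', AtomicEquiv w v w' v' → P w v → P w' v'
  | true :: Q, k, P => ∃ R, PrenexDefinable Q (k + 1) R ∧
      ∀ w v, P w v ↔ ∃ x, R w (Fin.snoc (α := fun _ => Fin n) v x)
  | false :: Q, k, P => ∃ R, PrenexDefinable Q (k + 1) R ∧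
      ∀ w v, P w v ↔ ∀ x, R w (Fin.snoc (α := fun _ => Fin n) v x)

/-! ### From prenex definability to formulas with a counted number of quantifiers. -/

section Formula

variable {L : FirstOrder.Language.{0, 0}} {α : Type} {k : ℕ}

theorem numQuantifiers_ex (φ : L.BoundedFormula α (k + 1)) :
    numQuantifiers φ.ex = numQuantifiers φ + 1 := rfl

theorem numQuantifiers_inf (φ ψ : L.BoundedFormula α k) :
    numQuantifiers (φ ⊓ ψ) = numQuantifiers φ + numQuantifiers ψ := rfl

theorem numQuantifiers_sup (φ ψ : L.BoundedFormula α k) :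
    numQuantifiers (φ ⊔ ψ) = numQuantifiers φ + numQuantifiers ψ := rfl

theorem numQuantifiers_iInf {β : Type*} [Finite β] (f : β → L.BoundedFormula α k)
    (hf : ∀ b, numQuantifiers (f b) = 0) : numQuantifiers (BoundedFormula.iInf f) = 0 := by
  simp only [BoundedFormula.iInf]
  generalize (@Finset.univ β (Fintype.ofFinite β)).toList = l
  induction l with
  | nil => rfl
  | cons b l ih => simpa [numQuantifiers_inf, hf] using ih

theorem numQuantifiers_iSup {β : Type*} [Finite β] (f : β → L.BoundedFormula α k)
    (hf : ∀ b, numQuantifiers (f b) = 0) : numQuantifiers (BoundedFormula.iSup f) = 0 := by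
  simp only [BoundedFormula.iSup]
  generalize (@Finset.univ β (Fintype.ofFinite β)).toList = l
  induction l with
  | nil => rfl
  | cons b l ih => simpa [numQuantifiers_sup, hf] using ih

end Formula

/-- The formula `φ` is true in the string `w` under the assignment `v`. -/
def Holds {n k : ℕ} (hn : 0 < n) (w : Fin n → Bool) (v : Fin k → Fin n)
    (φ : vocabulary.BoundedFormula Empty k) : Prop :=
  @BoundedFormula.Realize vocabulary (Fin n) (toStructure hn w) Empty k φ default v

section Holds

variable {n k : ℕ} (hn : 0 < n)

theorem exists_literal {P : (Fin n → Bool) → (Fin k → Fin n) → Prop}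
    {φ : vocabulary.BoundedFormula Empty k} (h0 : numQuantifiers φ = 0)
    (hφ : ∀ w v, Holds hn w v φ ↔ P w v) (p : Prop) :
    ∃ ψ : vocabulary.BoundedFormula Empty k, numQuantifiers ψ = 0 ∧
      ∀ w v, Holds hn w v ψ ↔ (p ↔ P w v) := by
  by_cases hp : p
  · exact ⟨φ, h0, by simpa [hp] using hφ⟩
  · refine ⟨φ.not, h0, fun w v => ?_⟩
    simp only [hp, false_iff, ← hφ]
    exact @BoundedFormula.realize_not vocabulary (Fin n) (toStructure hn w) _ _ _ _ _

theorem exists_formula_lt (i j : Fin k) :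
    ∃ φ : vocabulary.BoundedFormula Empty k, numQuantifiers φ = 0 ∧
      ∀ w v, Holds hn w v φ ↔ v i < v j := by
  refine ⟨.rel (L := vocabulary) Rel.lt ![.var (.inr i), .var (.inr j)], rfl, fun w v => ?_⟩
  rfl

theorem exists_formula_letter (i : Fin k) :
    ∃ φ : vocabulary.BoundedFormula Empty k, numQuantifiers φ = 0 ∧
      ∀ w v, Holds hn w v φ ↔ w (v i) = true := by
  refine ⟨.rel (L := vocabulary) Rel.S ![.var (.inr i)], rfl, fun w v => ?_⟩
  rfl

theorem exists_formula_min (i : Fin k) :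
    ∃ φ : vocabulary.BoundedFormula Empty k, numQuantifiers φ = 0 ∧
      ∀ w v, Holds hn w v φ ↔ (v i : ℕ) = 0 := by
  refine ⟨.equal (.var (.inr i)) (.func (L := vocabulary) Func.min ![]), rfl, fun w v => ?_⟩
  exact Fin.ext_iff

theorem exists_formula_max (i : Fin k) :
    ∃ φ : vocabulary.BoundedFormula Empty k, numQuantifiers φ = 0 ∧
      ∀ w v, Holds hn w v φ ↔ (v i : ℕ) = n - 1 := by
  refine ⟨.equal (.var (.inr i)) (.func (L := vocabulary) Func.max ![]), rfl, fun w v => ?_⟩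
  exact Fin.ext_iff

theorem holds_inf {w : Fin n → Bool} {v : Fin k → Fin n}
    {φ ψ : vocabulary.BoundedFormula Empty k} :
    Holds hn w v (φ ⊓ ψ) ↔ Holds hn w v φ ∧ Holds hn w v ψ :=
  @BoundedFormula.realize_inf vocabulary (Fin n) (toStructure hn w) _ _ _ _ _ _

theorem holds_iInf {β : Type*} [Finite β] {f : β → vocabulary.BoundedFormula Empty k}
    {w : Fin n → Bool} {v : Fin k → Fin n} :
    Holds hn w v (BoundedFormula.iInf f) ↔ ∀ b, Holds hn w v (f b) :=
  @BoundedFormula.realize_iInf vocabulary (Fin n) (toStructure hn w) _ _ _ _ _ _ _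

theorem holds_iSup {β : Type*} [Finite β] {f : β → vocabulary.BoundedFormula Empty k}
    {w : Fin n → Bool} {v : Fin k → Fin n} :
    Holds hn w v (BoundedFormula.iSup f) ↔ ∃ b, Holds hn w v (f b) :=
  @BoundedFormula.realize_iSup vocabulary (Fin n) (toStructure hn w) _ _ _ _ _ _ _

/-- A pebbled string is described up to `AtomicEquiv` by a quantifier-free formula. -/
theorem exists_formula_atomicEquiv (w : Fin n → Bool) (v : Fin k → Fin n) :
    ∃ φ : vocabulary.BoundedFormula Empty k, numQuantifiers φ = 0 ∧
      ∀ w' v', Holds hn w' v' φ ↔ AtomicEquiv w v w' v' := by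
  have hlt (p : Fin k × Fin k) : ∃ φ : vocabulary.BoundedFormula Empty k, numQuantifiers φ = 0 ∧
      ∀ w' v', Holds hn w' v' φ ↔ (v p.1 < v p.2 ↔ v' p.1 < v' p.2) := by
    obtain ⟨φ, h0, h⟩ := exists_formula_lt hn p.1 p.2
    exact exists_literal hn h0 h _
  have hS (i : Fin k) : ∃ φ : vocabulary.BoundedFormula Empty k, numQuantifiers φ = 0 ∧
      ∀ w' v', Holds hn w' v' φ ↔ (w (v i) = true ↔ w' (v' i) = true) := by
    obtain ⟨φ, h0, h⟩ := exists_formula_letter hn i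
    exact exists_literal hn h0 h _
  have hmin (i : Fin k) : ∃ φ : vocabulary.BoundedFormula Empty k, numQuantifiers φ = 0 ∧
      ∀ w' v', Holds hn w' v' φ ↔ ((v i : ℕ) = 0 ↔ (v' i : ℕ) = 0) := by
    obtain ⟨φ, h0, h⟩ := exists_formula_min hn i
    exact exists_literal hn h0 h _
  have hmax (i : Fin k) : ∃ φ : vocabulary.BoundedFormula Empty k, numQuantifiers φ = 0 ∧
      ∀ w' v', Holds hn w' v' φ ↔ ((v i : ℕ) = n - 1 ↔ (v' i : ℕ) = n - 1) := by
    obtain ⟨φ, h0, h⟩ := exists_formula_max hn i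
    exact exists_literal hn h0 h _
  choose f f0 hf using hlt
  choose g g0 hg using hS
  choose a a0 ha using hmin
  choose b b0 hb using hmax
  refine ⟨BoundedFormula.iInf f ⊓ BoundedFormula.iInf g ⊓ BoundedFormula.iInf a ⊓
    BoundedFormula.iInf b, ?_, fun w' v' => ?_⟩
  · simp only [numQuantifiers_inf, numQuantifiers_iInf _ f0, numQuantifiers_iInf _ g0,
      numQuantifiers_iInf _ a0, numQuantifiers_iInf _ b0]
  · simp only [holds_inf, holds_iInf, hf, hg, ha, hb]
    constructor
    · rintro ⟨⟨⟨h1, h2⟩, h3⟩, h4⟩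
      exact ⟨fun i j => h1 (i, j), fun i => Bool.eq_iff_iff.2 (h2 i), h3, h4⟩
    · rintro ⟨h1, h2, h3, h4⟩
      exact ⟨⟨⟨fun p => h1 p.1 p.2, fun i => by rw [h2]⟩, h3⟩, h4⟩

theorem PrenexDefinable.exists_formula {Q : List Bool} :
    ∀ {k : ℕ} {P : (Fin n → Bool) → (Fin k → Fin n) → Prop}, PrenexDefinable Q k P →
      ∃ φ : vocabulary.BoundedFormula Empty k, numQuantifiers φ = Q.length ∧
        ∀ w v, Holds hn w v φ ↔ P w v := by
  induction Q with
  | nil =>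
    intro k P h
    -- For fixed `n` there are finitely many pebbled strings, so the disjunction of their
    -- descriptions is a formula.
    choose φ φ0 hφ using fun p : {p : (Fin n → Bool) × (Fin k → Fin n) // P p.1 p.2} =>
      exists_formula_atomicEquiv hn p.1.1 p.1.2
    refine ⟨BoundedFormula.iSup φ, numQuantifiers_iSup _ φ0, fun w v => ?_⟩
    simp only [holds_iSup, hφ]
    constructor
    · rintro ⟨p, hp⟩
      exact h _ _ _ _ hp p.2
    · intro hp
      exact ⟨⟨(w, v), hp⟩, fun _ _ => Iff.rfl, fun _ => rfl, fun _ => Iff.rfl, fun _ => Iff.rfl⟩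
  | cons q Q ih =>
    intro k P h
    cases q with
    | true =>
      obtain ⟨R, hR, hP⟩ := h
      obtain ⟨φ, h0, hφ⟩ := ih hR
      refine ⟨φ.ex, by simp [numQuantifiers_ex, h0], fun w v => ?_⟩
      simp only [hP, ← hφ]
      exact @BoundedFormula.realize_ex vocabulary (Fin n) (toStructure hn w) _ _ _ _ _
    | false =>
      obtain ⟨R, hR, hP⟩ := h
      obtain ⟨φ, h0, hφ⟩ := ih hR
      refine ⟨φ.all, by simp [numQuantifiers, h0], fun w v => ?_⟩
      simp only [hP, ← hφ]
      exact @BoundedFormula.realize_all vocabulary (Fin n) (toStructure hn w) _ _ _ _ _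

end Holds

/-! ### Closure properties that keep the quantifier prefix. -/

namespace PrenexDefinable

variable {n k : ℕ} {Q : List Bool}

/-- A finite case distinction by atomic types does not need further quantifiers. -/
theorem select {ι : Type*} : ∀ {k : ℕ} {τ : (Fin n → Bool) → (Fin k → Fin n) → ι}
    {P : ι → (Fin n → Bool) → (Fin k → Fin n) → Prop},
    (∀ w v w' v', AtomicEquiv w v w' v' → τ w v = τ w' v') →
    (∀ i, PrenexDefinable Q k (P i)) → PrenexDefinable Q k fun w v => P (τ w v) w v := by
  induction Q with
  | nil =>
    intro k τ P hτ hP w v w' v' h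
    simp only [hτ _ _ _ _ h]
    exact hP _ _ _ _ _ h
  | cons q Q ih =>
    intro k τ P hτ hP
    have hinit {w w' : Fin n → Bool} {v v' : Fin (k + 1) → Fin n} (h : AtomicEquiv w v w' v') :
        τ w (Fin.init v) = τ w' (Fin.init v') := by
      apply hτ
      rw [← Fin.snoc_init_self v, ← Fin.snoc_init_self v'] at h
      exact h.of_snoc
    cases q with
    | true =>
      choose R hR hPR using hP
      exact ⟨fun w v => R (τ w (Fin.init v)) w v, ih (τ := fun w v => τ w (Fin.init v))
        (fun _ _ _ _ h => hinit h) hR, fun w v => by simp [hPR]⟩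
    | false =>
      choose R hR hPR using hP
      exact ⟨fun w v => R (τ w (Fin.init v)) w v, ih (τ := fun w v => τ w (Fin.init v))
        (fun _ _ _ _ h => hinit h) hR, fun w v => by simp [hPR]⟩

theorem const (hn : 0 < n) (p : Prop) :
    PrenexDefinable (n := n) Q k fun _ _ => p := by
  have : Nonempty (Fin n) := ⟨⟨0, hn⟩⟩
  induction Q generalizing k with
  | nil => exact fun _ _ _ _ _ h => h
  | cons q Q ih => cases q <;> exact ⟨fun _ _ => p, ih, fun w v => by simp⟩

theorem ite {E P P' : (Fin n → Bool) → (Fin k → Fin n) → Prop}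
    (hE : ∀ w v w' v', AtomicEquiv w v w' v' → (E w v ↔ E w' v'))
    (hP : PrenexDefinable Q k P) (hP' : PrenexDefinable Q k P') :
    PrenexDefinable Q k fun w v => (E w v → P w v) ∧ (¬ E w v → P' w v) := by
  have h := select (Q := Q) (τ := E)
    (P := fun p w v => (p → P w v) ∧ (¬ p → P' w v))
    (fun w v w' v' h => propext (hE w v w' v' h)) (fun p => ?_)
  · exact h
  · by_cases hp : p <;> simpa [hp]

theorem exists_block {m : ℕ} {R : (Fin n → Bool) → (Fin (k + m) → Fin n) → Prop}
    (hR : PrenexDefinable Q (k + m) R) :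
    PrenexDefinable (List.replicate m true ++ Q) k
      fun w v => ∃ s : Fin m → Fin n, R w (Fin.append v s) := by
  induction m generalizing Q with
  | zero =>
    simpa [Fin.append_right_nil, Unique.exists_iff] using hR
  | succ m ih =>
    have h : PrenexDefinable (true :: Q) (k + m)
      fun w v => ∃ x, R w (Fin.snoc (α := fun _ => Fin n) v x) := ⟨R, hR, fun _ _ => Iff.rfl⟩
    have h2 := ih h
    rw [List.replicate_succ', List.append_assoc, List.singleton_append]
    convert h2 using 3
    constructor
    · rintro ⟨s, hs⟩
      refine ⟨Fin.init s, s (Fin.last m), ?_⟩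
      rwa [← Fin.append_snoc, Fin.snoc_init_self]
    · rintro ⟨s, x, hs⟩
      exact ⟨Fin.snoc s x, by rwa [Fin.append_snoc]⟩

theorem forall_block {m : ℕ} {R : (Fin n → Bool) → (Fin (k + m) → Fin n) → Prop}
    (hR : PrenexDefinable Q (k + m) R) :
    PrenexDefinable (List.replicate m false ++ Q) k
      fun w v => ∀ s : Fin m → Fin n, R w (Fin.append v s) := by
  induction m generalizing Q with
  | zero =>
    simpa [Fin.append_right_nil, Unique.forall_iff] using hR
  | succ m ih =>
    have h : PrenexDefinable (false :: Q) (k + m)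
      fun w v => ∀ x, R w (Fin.snoc (α := fun _ => Fin n) v x) := ⟨R, hR, fun _ _ => Iff.rfl⟩
    have h2 := ih h
    rw [List.replicate_succ', List.append_assoc, List.singleton_append]
    convert h2 using 3
    constructor
    · intro hs s x
      rw [← Fin.append_snoc]
      exact hs _
    · intro hs s
      rw [← Fin.snoc_init_self s, Fin.append_snoc]
      exact hs _ _

end PrenexDefinable

/-! ### Distance bounds by repeated halving. -/

/-- The quantifier prefix `∀ ∃ ∀ ∃ ⋯ ∀ ∃` with `k` alternations. -/
def alternation : ℕ → List Bool
  | 0 => []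
  | k + 1 => false :: true :: alternation k

theorem length_alternation (k : ℕ) : (alternation k).length = 2 * k := by
  induction k with
  | zero => rfl
  | succ k ih => simp only [alternation, List.length_cons, ih]; ring

/-- The universal `x` picks one of the two gaps and cuts it. In a gap of length at least `d`, either
the part left of `x` has length at least `⌈d/2⌉` or the part right of it at least `⌊d/2⌋ + 1`. The
witness `z` names the long part by its side of `x` and splits it into halves, leaving two bounds of
size about `d/4`: again a statement about three points. In the right gap `x` exceeds `y`, and the
two roundings are exchanged. -/
theorem add_le_and_add_le_iff {n d e : ℕ} (u y v : Fin n) :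
    ((u : ℕ) + d ≤ y ∧ (y : ℕ) + e ≤ v) ↔ ∀ x : Fin n, ∃ z : Fin n,
      u ≤ y ∧ y ≤ v ∧ (1 ≤ e → y < v) ∧
      (u ≤ x ∧ x ≤ y →
        (z ≤ x → (u : ℕ) + ((d + 1) / 2 + 1) / 2 ≤ z ∧ (z : ℕ) + (d + 1) / 2 / 2 ≤ x) ∧
        (x < z → (x : ℕ) + ((d + 2) / 2 + 1) / 2 ≤ z ∧ (z : ℕ) + (d + 2) / 2 / 2 ≤ y)) ∧
      (y < x ∧ x ≤ v →
        (z ≤ x → (y : ℕ) + ((e + 2) / 2 + 1) / 2 ≤ z ∧ (z : ℕ) + (e + 2) / 2 / 2 ≤ x) ∧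
        (x < z → (x : ℕ) + ((e + 1) / 2 + 1) / 2 ≤ z ∧ (z : ℕ) + (e + 1) / 2 / 2 ≤ v)) := by
  simp only [Fin.le_def, Fin.lt_def]
  constructor
  · rintro ⟨h1, h2⟩ x
    by_cases hx : (x : ℕ) ≤ y
    · by_cases h : (u : ℕ) + (d + 1) / 2 ≤ x
      · exact ⟨⟨x - (d + 1) / 2 / 2, by omega⟩, by dsimp only; omega⟩
      · by_cases hu : (u : ℕ) ≤ x
        · exact ⟨⟨x + ((d + 2) / 2 + 1) / 2, by omega⟩, by dsimp only; omega⟩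
        · exact ⟨x, by omega⟩
    · by_cases h : (y : ℕ) + (e + 2) / 2 ≤ x
      · exact ⟨⟨x - (e + 2) / 2 / 2, by omega⟩, by dsimp only; omega⟩
      · by_cases hu : (x : ℕ) ≤ v
        · exact ⟨⟨x + ((e + 1) / 2 + 1) / 2, by omega⟩, by dsimp only; omega⟩
        · exact ⟨x, by omega⟩
  · intro H
    obtain ⟨_, h1, h2, h3, -⟩ := H u
    constructor
    · by_contra h
      -- The last `x` too close to `u` for the left option: the right option then forces the full
      -- distance.
      have hb : min (y : ℕ) (u + (d + 1) / 2 - 1) < n := by omega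
      obtain ⟨z, -, -, -, hz, -⟩ := H ⟨_, hb⟩
      dsimp only at hz
      omega
    · by_contra h
      -- For `e ≥ 2` this point lies strictly right of `y`; `e = 1` is covered by the clause `1 ≤ e
      -- → y < v`.
      have hb : min (v : ℕ) (y + (e + 2) / 2 - 1) < n := by omega
      obtain ⟨z, -, -, -, -, hz⟩ := H ⟨_, hb⟩
      dsimp only at hz
      omega

/-- The bound `d ≤ 4 ^ r / 2 + 1` survives quartering with all its upward roundings, and at `r = 0`
it leaves only `d ≤ 1`, which the order alone decides. -/
theorem prenexDefinable_add_le_and_add_le {n : ℕ} (hn : 0 < n) (r : ℕ) :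
    ∀ {k d e : ℕ} (i j l : Fin k), 2 * d ≤ 4 ^ r + 2 → 2 * e ≤ 4 ^ r + 2 →
      PrenexDefinable (n := n) (alternation r) k
        fun _ v => (v i : ℕ) + d ≤ v j ∧ (v j : ℕ) + e ≤ v l := by
  induction r with
  | zero =>
    intro k d e i j l hd he w v w' v' h
    have h1 := h.lt_iff i j
    have h2 := h.lt_iff j l
    have h3 := h.le_iff i j
    have h4 := h.le_iff j l
    simp only [Fin.lt_def, Fin.le_def] at h1 h2 h3 h4
    have hd' : d = 0 ∨ d = 1 := by omega
    have he' : e = 0 ∨ e = 1 := by omega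
    rcases hd' with rfl | rfl <;> rcases he' with rfl | rfl <;> dsimp only <;> omega
  | succ r ih =>
    intro k d e i j l hd he
    rw [pow_succ] at hd he
    obtain ⟨i', hi⟩ : ∃ a, a = i.castSucc.castSucc := ⟨_, rfl⟩
    obtain ⟨j', hj⟩ : ∃ a, a = j.castSucc.castSucc := ⟨_, rfl⟩
    obtain ⟨l', hl⟩ : ∃ a, a = l.castSucc.castSucc := ⟨_, rfl⟩
    obtain ⟨x, hx⟩ : ∃ a, a = (Fin.last k).castSucc := ⟨_, rfl⟩
    obtain ⟨z, hz⟩ : ∃ a, a = Fin.last (k + 1) := ⟨_, rfl⟩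
    have key := PrenexDefinable.ite (n := n)
      (E := fun _ p => p i' ≤ p j' ∧ p j' ≤ p l' ∧ (1 ≤ e → p j' < p l'))
      (fun w v w' v' h => by simp only [h.le_iff, h.lt_iff])
      (PrenexDefinable.ite (E := fun _ p => p i' ≤ p x ∧ p x ≤ p j')
        (fun w v w' v' h => by simp only [h.le_iff])
        (PrenexDefinable.ite (E := fun _ p => p z ≤ p x)
          (fun w v w' v' h => by simp only [h.le_iff])
          (ih (d := ((d + 1) / 2 + 1) / 2) (e := (d + 1) / 2 / 2) i' z x (by omega) (by omega))
          (ih (d := ((d + 2) / 2 + 1) / 2) (e := (d + 2) / 2 / 2) x z j' (by omega) (by omega)))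
        (PrenexDefinable.ite (E := fun _ p => p j' < p x ∧ p x ≤ p l')
          (fun w v w' v' h => by simp only [h.le_iff, h.lt_iff])
          (PrenexDefinable.ite (E := fun _ p => p z ≤ p x)
            (fun w v w' v' h => by simp only [h.le_iff])
            (ih (d := ((e + 2) / 2 + 1) / 2) (e := (e + 2) / 2 / 2) j' z x (by omega) (by omega))
            (ih (d := ((e + 1) / 2 + 1) / 2) (e := (e + 1) / 2 / 2) x z l' (by omega) (by omega)))
          (PrenexDefinable.const hn True)))
      (PrenexDefinable.const hn False)
    refine ⟨_, ⟨_, key, fun _ _ => Iff.rfl⟩, fun w v => ?_⟩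
    refine (add_le_and_add_le_iff (v i) (v j) (v l)).trans ?_
    refine forall_congr' fun a => exists_congr fun b => ?_
    simp only [hi, hj, hl, hx, hz, Fin.snoc_castSucc, Fin.snoc_last, not_le, imp_false,
      implies_true, and_true, not_and]
    clear key ih
    grind

/-! ### Sentences about a given string. -/

theorem PrenexDefinable.exists_sentence {n : ℕ} (hn : 0 < n) {Q : List Bool}
    {P : (Fin n → Bool) → (Fin 0 → Fin n) → Prop} (h : PrenexDefinable Q 0 P) :
    ∃ φ : vocabulary.Sentence, numQuantifiers φ = Q.length ∧
      ∀ w, Satisfies hn w φ ↔ P w default := by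
  obtain ⟨φ, h0, hφ⟩ := h.exists_formula hn
  exact ⟨φ, h0, fun w => hφ w default⟩

/-- A string of length `n` is defined by an existential sentence with `n` quantifiers. -/
theorem exists_sentence_numQuantifiers_eq_length {n : ℕ} (hn : 0 < n) (w : Fin n → Bool) :
    ∃ φ : vocabulary.Sentence, numQuantifiers φ = n ∧ ∀ w', Satisfies hn w' φ ↔ w' = w := by
  have h : PrenexDefinable (n := n) [] (0 + n) fun w' v =>
      (∀ i j : Fin n, i < j → v (Fin.natAdd 0 i) < v (Fin.natAdd 0 j)) ∧
      ∀ i : Fin n, w' (v (Fin.natAdd 0 i)) = w i := by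
    intro w₁ v₁ w₂ v₂ h
    simp only [h.lt_iff, h.letter_eq, imp_self]
  obtain ⟨φ, h0, hφ⟩ := h.exists_block.exists_sentence hn
  refine ⟨φ, by simpa using h0, fun w' => (hφ w').trans ?_⟩
  simp only [Fin.append_right]
  constructor
  · rintro ⟨s, hs, hw⟩
    have hs' : StrictMono s := fun i j hij => hs i j hij
    have hid : s = id := by
      have := Subsingleton.elim (hs'.orderIsoOfSurjective s
        (Finite.surjective_of_injective hs'.injective)) (OrderIso.refl (Fin n))
      exact congrArg (fun e : Fin n ≃o Fin n => (e : Fin n → Fin n)) this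
    subst hid
    exact funext hw
  · rintro rfl
    exact ⟨id, fun i j hij => hij, fun i => rfl⟩

/-- Given a family of positions indexed by words of length `K` over an alphabet with `t` letters,
where `t ≤ n`, the strings agreeing with `w` at all these positions are defined by a sentence in
which `t` existential quantifiers mark the letters and `K` universal quantifiers choose the
word. -/
theorem exists_sentence_agree {n t K r : ℕ} (hn : 0 < n) (ht : t ≤ n) (hr : 2 * n ≤ 4 ^ r)
    (w : Fin n → Bool) (g : (Fin K → Fin t) → Fin n) :
    ∃ φ : vocabulary.Sentence, numQuantifiers φ = t + (K + (3 + 2 * r)) ∧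
      ∀ w', Satisfies hn w' φ ↔ ∀ c, w' (g c) = w (g c) := by
  let x (v : Fin (0 + t + K + 3) → Fin n) (i : Fin t) : Fin n :=
    v (Fin.castAdd 3 (Fin.castAdd K (Fin.natAdd 0 i)))
  let y (v : Fin (0 + t + K + 3) → Fin n) (j : Fin K) : Fin n :=
    v (Fin.castAdd 3 (Fin.natAdd (0 + t) j))
  let s (v : Fin (0 + t + K + 3) → Fin n) (m : Fin 3) : Fin n := v (Fin.natAdd (0 + t + K) m)
  have hdist (c : Fin K → Fin t) : PrenexDefinable (alternation r) (0 + t + K + 3) fun w' v =>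
      (w' (s v 2) = w (g c) → (s v 0 : ℕ) + g c ≤ s v 2 ∧ (s v 2 : ℕ) + (n - 1 - g c) ≤ s v 1) ∧
        (¬ w' (s v 2) = w (g c) → False) :=
    PrenexDefinable.ite (fun w₁ v₁ w₂ v₂ h => by simp only [s, h.letter_eq])
      (prenexDefinable_add_le_and_add_le hn r _ _ _ (by omega) (by omega))
      (PrenexDefinable.const hn False)
  -- The atomic type determines which words the `y` spell in the letters `x`. Unless there is
  -- exactly one, nothing is claimed.
  have hcode := PrenexDefinable.select (n := n) (Q := alternation r) (k := 0 + t + K + 3)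
    (τ := fun _ v => {c | ∀ j, y v j = x v (c j)})
    (P := fun S w' v => ∀ c, S = {c} →
      (w' (s v 2) = w (g c) → (s v 0 : ℕ) + g c ≤ s v 2 ∧ (s v 2 : ℕ) + (n - 1 - g c) ≤ s v 1) ∧
        (¬ w' (s v 2) = w (g c) → False))
    (fun w₁ v₁ w₂ v₂ h => by simp only [x, y, h.eq_iff])
    (fun S => by
      by_cases hS : ∃ c, S = {c}
      · obtain ⟨c, rfl⟩ := hS
        convert hdist c using 3
        simp only [Set.singleton_eq_singleton_iff, forall_eq']
      · push Not at hS
        simpa [hS] using PrenexDefinable.const hn True)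
  have hmain := (PrenexDefinable.ite (P' := fun _ _ => False)
    (E := fun _ v => Function.Injective (x v) ∧ (s v 0 : ℕ) = 0 ∧ (s v 1 : ℕ) = n - 1)
    (fun w₁ v₁ w₂ v₂ h => by
      simp only [Function.Injective, x, s, h.eq_iff, h.min_iff, h.max_iff])
    hcode (PrenexDefinable.const hn False)).exists_block.forall_block.exists_block
  obtain ⟨φ, h0, hφ⟩ := hmain.exists_sentence hn
  refine ⟨φ, h0.trans (by simp [length_alternation]; omega), fun w' => (hφ w').trans ?_⟩
  clear hmain hcode hdist hφ h0
  simp only [x, y, s, Fin.append_left, Fin.append_right, imp_false, not_not]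
  constructor
  · rintro ⟨x, hx⟩ c
    obtain ⟨z, ⟨hinj, h0, h1⟩, hz⟩ : ∃ z : Fin 3 → Fin n, (Function.Injective x ∧ (z 0 : ℕ) = 0 ∧
        (z 1 : ℕ) = n - 1) ∧ ∀ c', {c'' | ∀ j, x (c j) = x (c'' j)} = {c'} →
          (w' (z 2) = w (g c') → (z 0 : ℕ) + g c' ≤ z 2 ∧ (z 2 : ℕ) + (n - 1 - g c') ≤ z 1) ∧
          w' (z 2) = w (g c') := by
      obtain ⟨z, h1, h2⟩ := hx fun j => x (c j)
      exact ⟨z, h2, h1 h2⟩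
    obtain ⟨h2, h3⟩ := hz c (by
      ext c'
      simp only [hinj.eq_iff, Set.mem_ofPred_eq, Set.mem_singleton_iff, funext_iff, eq_comm])
    have h4 := h2 h3
    -- The two lower bounds add up to `n - 1`, the distance between the ends, so both are
    -- equalities.
    have : z 2 = g c := by ext; omega
    rwa [← this] at h3 ⊢
  · intro h
    refine ⟨Fin.castLE ht, fun y => ?_⟩
    by_cases hy : ∃ c : Fin K → Fin t, {c' | ∀ j, y j = Fin.castLE ht (c' j)} = {c}
    · obtain ⟨c, hc⟩ := hy
      refine ⟨![⟨0, hn⟩, ⟨n - 1, by omega⟩, g c], ?_⟩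
      have := (g c).2
      simp only [hc, Set.singleton_eq_singleton_iff, forall_eq']
      simp [h, Fin.castLE_injective]
      omega
    · push Not at hy
      -- No word is spelled, so the guessed position is arbitrary.
      refine ⟨![⟨0, hn⟩, ⟨n - 1, by omega⟩, ⟨0, hn⟩], ?_⟩
      simp [hy, Fin.castLE_injective]

end BitString

/-! ### Choice of the parameters. -/

theorem theorem4 (t : ℕ) (ht : 2 ≤ t) :
    ∃ C : ℝ, ∀ f : ℕ → ℕ, Tendsto f atTop atTop →
      ∀ (n : ℕ) (hn : 0 < n) (w : Fin n → Bool) (B : Finset (Fin n → Bool)),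
        w ∉ B → B.card = f n →
          ∃ φ : BitString.vocabulary.Sentence,
            BitString.Separates hn φ {w} (B : Set (Fin n → Bool)) ∧
            (BitString.numQuantifiers φ : ℝ) ≤
              Real.logb 2 (n : ℝ) + Real.logb (t : ℝ) (f n : ℝ) + C := by
  -- `t` letters and 3 guesses, plus 1 from rounding `K` and 4 from rounding `2 * r`.
  refine ⟨t + 8, fun f _ n hn w B hw hB => ?_⟩
  have ht1 : (1 : ℝ) < t := by exact_mod_cast ht
  have hn1 : (1 : ℝ) ≤ n := by exact_mod_cast hn
  have hlogn : 0 ≤ Real.logb 2 (n : ℝ) := Real.logb_nonneg one_lt_two hn1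
  have hlogf : 0 ≤ Real.logb (t : ℝ) (f n : ℝ) := by
    rcases Nat.eq_zero_or_pos (f n) with h | h
    · simp [h]
    · exact Real.logb_nonneg ht1 (by exact_mod_cast h)
  rcases lt_or_ge n t with hnt | hnt
  · obtain ⟨φ, h0, hφ⟩ := BitString.exists_sentence_numQuantifiers_eq_length hn w
    refine ⟨φ, ⟨by simp [hφ], fun b hb => ?_⟩, ?_⟩
    · rw [hφ]
      rintro rfl
      exact hw hb
    · have : (n : ℝ) ≤ t := by exact_mod_cast hnt.le
      rw [h0]
      linarith
  obtain ⟨K, hK, hKlog⟩ : ∃ K : ℕ, B.card ≤ t ^ K ∧ (K : ℝ) ≤ Real.logb t (f n) + 1 := by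
    rcases Nat.eq_zero_or_pos (f n) with h | h
    · exact ⟨0, by omega, by simp [h]⟩
    · obtain ⟨p, hp, hp'⟩ := exists_nat_pow_near (x := f n) (y := t) h (by omega)
      refine ⟨p + 1, hB ▸ hp'.le, ?_⟩
      have : (p : ℝ) ≤ Real.logb t (f n) := by
        rw [Real.le_logb_iff_rpow_le ht1 (by exact_mod_cast h), Real.rpow_natCast]
        exact_mod_cast hp
      push_cast
      linarith
  obtain ⟨r, hr, hrlog⟩ : ∃ r : ℕ, 2 * n ≤ 4 ^ r ∧ (2 * r : ℝ) ≤ Real.logb 2 n + 4 := by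
    obtain ⟨p, hp, hp'⟩ := exists_nat_pow_near (x := n) (y := 4) hn (by omega)
    refine ⟨p + 2, by rw [pow_succ] at hp' ⊢; omega, ?_⟩
    have : ((2 * p : ℕ) : ℝ) ≤ Real.logb 2 n := by
      rw [Real.le_logb_iff_rpow_le one_lt_two (by positivity), Real.rpow_natCast, pow_mul]
      norm_num
      exact_mod_cast hp
    push_cast at this ⊢
    linarith
  obtain ⟨e⟩ : Nonempty (B ↪ (Fin K → Fin t)) :=
    Function.Embedding.nonempty_of_card_le (by simpa using hK)
  have hdiff (b : B) : ∃ i, b.1 i ≠ w i := by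
    by_contra! h
    exact hw (funext h ▸ b.2)
  choose d hd using hdiff
  -- Words that code no element of `B` get position 0; this is harmless, as `w` agrees with itself
  -- everywhere.
  obtain ⟨φ, h0, hφ⟩ := BitString.exists_sentence_agree hn hnt hr w
    (Function.extend e d fun _ => ⟨0, hn⟩)
  refine ⟨φ, ⟨by simp [hφ], fun b hb h => ?_⟩, ?_⟩
  · have := (hφ b).1 h (e ⟨b, hb⟩)
    rw [e.injective.extend_apply] at this
    exact hd ⟨b, hb⟩ this
  · rw [h0]
    push_cast
    linarith
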